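/- Let $K$ be an algebraically closed field and $\boldsymbol{k}\subsetneq K$ a proper algebraically closed subfield. View $(K,\boldsymbol{k})$ as a structure in the language of rings augmented by a unary relation symbol $U$ interpreted as $\boldsymbol{k}$; "definable" means definable in this structure with parameters from $K$. For a set $S\subseteq K^n$ define $\dim_2 S$ as follows. If $S=\emptyset$, put $\dim_2 S:=-\infty$. If $S\neq\emptyset$, let $\kappa>|K|$ be a cardinal and let $(K^*,\boldsymbol{k}^*,S^*)$ be a $\kappa$-saturated elementary extension of $(K,\boldsymbol{k},S)$, where an $n$-ary relation symbol naming $S$ has been added to the language; put $$\dim_2 S:=\max\big\{\operatorname{trdeg}\big(K\boldsymbol{k}^*(s)\,|\,K\boldsymbol{k}^*\big): s\in S^*\big\},$$ where $K\boldsymbol{k}^*$ is the subfield of $K^*$ generated by $K$ and $\boldsymbol{k}^*$. (This transcendence degree is the rank of $s$ over $K$ in the pregeometry on $K^*$ that sends $A\subseteq K^*$ to the algebraic closure of $\boldsymbol{k}^*(A)$ in $K^*$; the value $\dim_2 S$ does not depend on the choice of $\kappa$ and of the extension.) **Proposition.** If $S\subseteq K$ is definable in $(K,\boldsymbol{k})$,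 then $\dim_2 S\le 0$ or $\dim_2(K\setminus S)\le 0$. -/

import Mathlib

universe u

namespace PairACF

/-- A single relation symbol, of arity `n`. -/
inductive NewRel (n : ℕ) : ℕ → Type
  | rel : NewRel n n

/-- The language with one relation symbol, of arity `n`, and nothing else. -/
def newRelLang (n : ℕ) : FirstOrder.Language :=
  { Functions := fun _ => Empty
    Relations := NewRel n }

/-- The interpretation of the `n`-ary relation symbol by a set `S` of `n`-tuples. -/
@[reducible] def newRelStructure {n : ℕ} {M : Type u} (S : Set (Fin n → M)) :
    (newRelLang n).Structure M where
  funMap := fun f => f.elim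
  RelMap := fun {_} r =>
    match r with
    | NewRel.rel => fun v => v ∈ S

/-- The language of rings augmented by a unary relation symbol. -/
abbrev pairLang : FirstOrder.Language := FirstOrder.Language.ring.sum (newRelLang 1)

/-- The language of pairs augmented by an `n`-ary relation symbol. -/
abbrev pairSetLang (n : ℕ) : FirstOrder.Language := pairLang.sum (newRelLang n)

/-- The pair `(K, k)` as a structure: the ring `K` with the unary symbol interpreted as `k`. -/
@[reducible] def pairStructure {K : Type u} [Field K] (k : Subfield K) : pairLang.Structure K :=
  letI : FirstOrder.Language.ring.Structure K := (FirstOrder.Ring.compatibleRingOfRing K).toStructure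
  letI : (newRelLang 1).Structure K := newRelStructure {v : Fin 1 → K | v 0 ∈ k}
  inferInstance

/-- The expansion `(K, k, S)` of the pair `(K, k)` by a set `S` of `n`-tuples, not necessarily
definable. -/
@[reducible] def pairSetStructure {n : ℕ} {K : Type u} [Field K] (k : Subfield K)
    (S : Set (Fin n → K)) : (pairSetLang n).Structure K :=
  letI : pairLang.Structure K := pairStructure k
  letI : (newRelLang n).Structure K := newRelStructure S
  inferInstance

/-- `S ⊆ K` is definable, with parameters from `K`, in the pair `(K, k)`. -/
def DefinableInPair {K : Type u} [Field K] (k : Subfield K) (S : Set K) : Prop :=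
  letI : pairLang.Structure K := pairStructure k
  (Set.univ : Set K).Definable₁ pairLang S

/-- `M` is `κ`-saturated: over every parameter set `A ⊆ M` of size less than `κ`, every set of
formulas in one free variable that is finitely satisfiable in `M` is realized in `M`. -/
def IsSaturated (L : FirstOrder.Language.{0, 0}) (κ : Cardinal.{u}) (M : Type u) [L.Structure M] : Prop :=
  ∀ A : Set M, Cardinal.mk A < κ →
    ∀ p : Set ((L.withConstants A).Formula (Fin 1)),
      (∀ q : Finset ((L.withConstants A).Formula (Fin 1)), (q : Set _) ⊆ p →
        ∃ v : Fin 1 → M, ∀ φ ∈ q, φ.Realize v) →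
      ∃ v : Fin 1 → M, ∀ φ ∈ p, φ.Realize v

/-- A `κ`-saturated elementary extension `(F, k', S')` of `(K, k, S)` for some `κ > |K|`.
An elementary extension of a field is again a field, so `F` is taken to be a field with its
standard ring structure. -/
structure SatExt {n : ℕ} {K : Type u} [Field K] (k : Subfield K) (S : Set (Fin n → K)) where
  F : Type u
  [field : Field F]
  k' : Subfield F
  S' : Set (Fin n → F)
  emb : @FirstOrder.Language.ElementaryEmbedding (pairSetLang n) K F
    (pairSetStructure k S) (pairSetStructure k' S')
  κ : Cardinal.{u}
  card_lt : Cardinal.mk K < κ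
  saturated : @IsSaturated (pairSetLang n) κ F (pairSetStructure k' S')

attribute [instance] SatExt.field

namespace SatExt

variable {n : ℕ} {K : Type u} [Field K] {k : Subfield K} {S : Set (Fin n → K)}

/-- The subfield `K k'` of `F` generated by (the image of) `K` and `k'`. -/
def base (E : SatExt k S) : Subfield E.F :=
  letI := pairSetStructure k S
  letI := pairSetStructure E.k' E.S'
  Subfield.closure (Set.range (E.emb : K → E.F) ∪ (E.k' : Set E.F))

/-- The rank of the tuple `s` over `K` in the pregeometry `A ↦ acl(k'(A))` on `F`: the
transcendence degree of `K k'(s)` over `K k'`. -/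
noncomputable def rk (E : SatExt k S) (s : Fin n → E.F) : Cardinal.{u} :=
  Algebra.trdeg E.base (IntermediateField.adjoin E.base (Set.range s))

end SatExt

/-- The dimension `dim₂ S` of a set `S` of `n`-tuples in the pair `(K, k)`, with `⊥` in the role
of `-∞`. For nonempty `S` it is the largest rank over `K` of a point of `S'`, where `(F, k', S')`
is a `κ`-saturated elementary extension of `(K, k, S)` with `κ > |K|`. All these ranks are at
most `n`, and their maximum does not depend on the choice of the extension, so it is written as
the supremum over all such extensions. -/
noncomputable def dim₂ {n : ℕ} {K : Type u} [Field K] (k : Subfield K) (S : Set (Fin n → K)) :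
    WithBot ℕ∞ :=
  ⨆ (E : SatExt k S) (s : Fin n → E.F) (_ : s ∈ E.S'),
    ((Cardinal.toENat (E.rk s) : ℕ∞) : WithBot ℕ∞)

/-- The dimension of a subset of `K`, regarded as a set of `1`-tuples. -/
noncomputable def dim₂One {K : Type u} [Field K] (k : Subfield K) (S : Set K) : WithBot ℕ∞ :=
  dim₂ k {v : Fin 1 → K | v 0 ∈ S}

end PairACF

/-!
Let `(F, k')` be an elementary extension of `(K, k)`. Any two elements of `F` that are
transcendental over the compositum `K k'` are conjugate under an automorphism of `F` over `K k'`,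
because `F` is algebraically closed (`exists_algEquiv_map_eq_of_transcendental`). Such an
automorphism fixes `K` and `k'` pointwise, hence preserves every set definable in `(F, k')` over
`K` (`SatExt.mem_of_algEquiv`). So the set `S'` defined by the formula that defines `S` contains
all elements transcendental over `K k'` or none.

The dimensions of `S` and of its complement are suprema over unrelated families of extensions, of
`(K, k, S)` and of `(K, k, Sᶜ)`, and the two are compared through a property of subsets of `K`
itself. An element is algebraic over `K k'` if and only if it solves a nontrivial polynomial
equation whose coefficients are `K`-linear in auxiliary unknowns from `k'` (`Locus.Mem`), and a set
is called small if finitely many such equations cover it (`IsSmall`). Smallness is first-order, so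
a small set has dimension at most `0` in every extension (`IsSmall.dim₂One_le`). If `S` has
positive dimension, then in some saturated extension all elements outside `S'` are algebraic over
`K k'`, and by saturation finitely many equations cover them (`SatExt.isSmall_compl`). Thus `Sᶜ` is
small.
-/

namespace PairACF

section Algebra

/-! ### Conjugate transcendental elements -/

/-- Two elements of an algebraically closed field that are transcendental over a subfield `B` are
conjugate over `B`: each of them extends to a transcendence basis, and a bijection of these bases
that matches the two elements induces an automorphism. -/
theorem exists_algEquiv_map_eq_of_transcendental {B F : Type*} [Field B] [Field F] [Algebra B F]
    [IsAlgClosed F] {s t : F} (hs : Transcendental B s) (ht : Transcendental B t) :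
    ∃ σ : F ≃ₐ[B] F, σ s = t := by
  classical
  have aeval_X : ∀ {Z : Set F} (hZ : AlgebraicIndependent B ((↑) : Z → F)) (z : Z),
      (hZ.aevalEquiv (MvPolynomial.X z) : F) = z := fun hZ z => by simp
  have exists_basis : ∀ {s : F}, Transcendental B s → ∃ X : Set F, s ∈ X ∧
      IsTranscendenceBasis B ((↑) : X → F) := fun {s} hs => by
    obtain ⟨X, hsX, hX⟩ := exists_isTranscendenceBasis_superset (R := B) (s := ({s} : Set F))
      ((algebraicIndependent_singleton_iff (i := (⟨s, rfl⟩ : ({s} : Set F)))).2 hs)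
    exact ⟨X, hsX rfl, hX⟩
  obtain ⟨X, hsX, hX⟩ := exists_basis hs
  obtain ⟨Y, htY, hY⟩ := exists_basis ht
  obtain ⟨e₀⟩ := Cardinal.eq.1 (hX.cardinalMk_eq hY)
  -- Correct an arbitrary bijection of the bases by a transposition.
  let e : X ≃ Y := e₀.trans (Equiv.swap (e₀ ⟨s, hsX⟩) ⟨t, htY⟩)
  have he : e ⟨s, hsX⟩ = ⟨t, htY⟩ := by simp [e]
  have hXi : AlgebraicIndependent B ((↑) : X → F) := hX.1
  have hYi : AlgebraicIndependent B ((↑) : Y → F) := hY.1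
  let A := Algebra.adjoin B (Set.range ((↑) : X → F))
  let C := Algebra.adjoin B (Set.range ((↑) : Y → F))
  let f : A ≃ₐ[B] C := hXi.aevalEquiv.symm.trans
    ((MvPolynomial.renameEquiv B e).trans hYi.aevalEquiv)
  have hA : IsAlgClosure A F := IsAlgClosed.isAlgClosure_of_transcendence_basis _ hX
  have hC : IsAlgClosure C F := IsAlgClosed.isAlgClosure_of_transcendence_basis _ hY
  let g : F ≃+* F := IsAlgClosure.equivOfEquiv F F f.toRingEquiv
  have hg : ∀ a : A, g a = f a := fun a =>
    IsAlgClosure.equivOfEquiv_algebraMap F F f.toRingEquiv a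
  refine ⟨AlgEquiv.ofRingEquiv (f := g) fun b => ?_, ?_⟩
  · have := hg (algebraMap B A b)
    rw [f.commutes] at this
    exact this
  · have h1 : f ⟨s, Algebra.subset_adjoin ⟨⟨s, hsX⟩, rfl⟩⟩ =
        ⟨t, Algebra.subset_adjoin ⟨⟨t, htY⟩, rfl⟩⟩ := by
      have : hXi.aevalEquiv (MvPolynomial.X ⟨s, hsX⟩) =
          ⟨s, Algebra.subset_adjoin ⟨⟨s, hsX⟩, rfl⟩⟩ := Subtype.ext (aeval_X hXi _)
      rw [← this]
      apply Subtype.ext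
      simp only [f, AlgEquiv.trans_apply, AlgEquiv.symm_apply_apply, MvPolynomial.renameEquiv_apply,
        MvPolynomial.rename_X, he]
      exact aeval_X hYi _
    exact (hg ⟨s, _⟩).trans (congrArg Subtype.val h1)

/-! ### Algebraicity over the compositum, by explicit equations -/

/-- The data of an equation `∑ i < d, (∑ j < m i, b i j * y i j) * x ^ i = 0`, with coefficients
`b i j`, in an unknown `x` and auxiliary unknowns `y i j` that are to range over a subfield. -/
structure Locus (K : Type*) where
  d : ℕ
  m : Fin d → ℕ
  b : ∀ i, Fin (m i) → K

namespace Locus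
variable {K F : Type*} [Field F]

/-- The coefficient of `x ^ i` in the equation `I`, with the `b i j` carried along `f`. -/
def coeff (I : Locus K) (f : K → F) (y : (Σ i, Fin (I.m i)) → F) (i : Fin I.d) : F :=
  ∑ j, f (I.b i j) * y ⟨i, j⟩

/-- `x` satisfies the equation `I`, with the `b i j` carried along `f`, for some values in `k'` of
the auxiliary unknowns that do not make it trivial in `x`. -/
def Mem (I : Locus K) (k' : Subfield F) (f : K → F) (x : F) : Prop :=
  ∃ y : (Σ i, Fin (I.m i)) → F, (∀ p, y p ∈ k') ∧ (∃ i, I.coeff f y i ≠ 0) ∧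
    ∑ i, I.coeff f y i * x ^ (i : ℕ) = 0

theorem Mem.isAlgebraic {I : Locus K} {k' : Subfield F} {f : K → F} {x : F}
    (h : I.Mem k' f x) : IsAlgebraic (Subfield.closure (Set.range f ∪ k')) x := by
  obtain ⟨y, hy, ⟨i₀, hi₀⟩, h0⟩ := h
  have hc : ∀ i, I.coeff f y i ∈ Subfield.closure (Set.range f ∪ k') := fun i =>
    sum_mem fun j _ => mul_mem (Subfield.subset_closure (Or.inl ⟨_, rfl⟩))
      (Subfield.subset_closure (Or.inr (hy _)))
  let c : Fin I.d → Subfield.closure (Set.range f ∪ (k' : Set F)) := fun i => ⟨_, hc i⟩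
  refine ⟨∑ i : Fin I.d, Polynomial.monomial (i : ℕ) (c i), fun hp => hi₀ ?_, ?_⟩
  · have := congrArg (fun p => ((p.coeff i₀ : Subfield.closure (Set.range f ∪ (k' : Set F))) : F)) hp
    simpa [Polynomial.finsetSum_coeff, Polynomial.coeff_monomial, Fin.val_inj, c] using this
  · simpa [Polynomial.aeval_monomial, c, Algebra.algebraMap_ofSubsemiring_apply] using h0

/-- The subfield generated by `K` and `k'` is the fraction field of the `K`-algebra generated by
`k'`. So an element algebraic over it is a root of a nonzero polynomial over that algebra, which is
the `K`-linear span of `k'`. -/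
theorem exists_mem_of_isAlgebraic [Field K] {k' : Subfield F} {f : K →+* F} {x : F}
    (h : IsAlgebraic (Subfield.closure (Set.range f ∪ k')) x) :
    ∃ I : Locus K, I.Mem k' f x := by
  algebraize [f]
  -- The intermediate field is by definition this subfield closure.
  have h' : IsAlgebraic (IntermediateField.adjoin K (k' : Set F)) x := h
  rw [IntermediateField.isAlgebraic_adjoin_iff] at h'
  obtain ⟨p, hp0, hp⟩ := h'
  have hspan : ∀ c : Algebra.adjoin K (k' : Set F), ∃ (n : ℕ) (b : Fin n → K)
      (y : Fin n → (k' : Set F)), ∑ i, b i • (y i : F) = c := fun c => by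
    have hc : (c : F) ∈ Subalgebra.toSubmodule (Algebra.adjoin K (k' : Set F)) := c.2
    rw [Algebra.adjoin_eq_span,
      show Submonoid.closure (k' : Set F) = k'.toSubmonoid from
        Submonoid.closure_eq k'.toSubmonoid] at hc
    exact Submodule.mem_span_set'.1 hc
  choose m b y hy using hspan
  let I : Locus K := ⟨p.natDegree + 1, fun i => m (p.coeff i), fun i => b (p.coeff i)⟩
  have hI : ∀ i, I.coeff f (fun q => y (p.coeff q.1) q.2) i = p.coeff i := fun i => by
    rw [← hy (p.coeff i)]
    simp only [Algebra.smul_def]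
    rfl
  refine ⟨I, fun q => y (p.coeff q.1) q.2, fun q => (y _ _).2, ⟨Fin.last _, ?_⟩, ?_⟩
  · rw [hI]
    simpa using hp0
  · simp only [hI]
    rw [Polynomial.aeval_eq_sum_range, Finset.sum_range] at hp
    simpa [Algebra.smul_def] using hp

end Locus
end Algebra

section ModelTheory

/-! ### Truth in expanded pairs -/

open FirstOrder FirstOrder.Language
variable {n : ℕ} {α β : Type*}

/-- The formula `φ` holds of `v` in the structure `(F, k, S)`, which is an explicit argument
because it is not an instance. -/
def Sat {F : Type u} [Field F] (k : Subfield F) (S : Set (Fin n → F))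
    (φ : (pairSetLang n).Formula α) (v : α → F) : Prop :=
  letI := pairSetStructure k S
  φ.Realize v

/-- The formula `p = 0`, for a polynomial `p` over `ℤ` in the variables. -/
noncomputable def polyEqZero (p : FreeCommRing α) : (pairSetLang n).Formula α :=
  (LHom.sumInl.comp LHom.sumInl : Language.ring →ᴸ pairSetLang n).onFormula
    ((FirstOrder.Ring.termOfFreeCommRing p).equal 0)

/-- The formula saying that `a` lies in the distinguished subfield. -/
def memSubfield (a : α) : (pairSetLang n).Formula α :=
  Relations.formula (L := pairSetLang n) (Sum.inl (Sum.inr NewRel.rel)) ![Term.var a]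

/-- The formula saying that the tuple `a` lies in the named set. -/
def memSet (a : Fin n → α) : (pairSetLang n).Formula α :=
  Relations.formula (L := pairSetLang n) (Sum.inr NewRel.rel) fun i => Term.var (a i)

variable {F : Type u} [Field F] {k : Subfield F} {S : Set (Fin n → F)} {v : α → F}

theorem sat_ring (φ : Language.ring.Formula α) :
    Sat k S ((LHom.sumInl.comp LHom.sumInl : Language.ring →ᴸ pairSetLang n).onFormula φ) v ↔
      letI := FirstOrder.Ring.compatibleRingOfRing F
      φ.Realize v := by
  let := FirstOrder.Ring.compatibleRingOfRing F
  let := pairSetStructure k S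
  have : (LHom.sumInl.comp LHom.sumInl : Language.ring →ᴸ pairSetLang n).IsExpansionOn F :=
    ⟨fun _ _ => rfl, fun _ _ => rfl⟩
  exact LHom.realize_onFormula _ φ

theorem sat_polyEqZero (p : FreeCommRing α) :
    Sat k S (polyEqZero p) v ↔ FreeCommRing.lift v p = 0 := by
  let := FirstOrder.Ring.compatibleRingOfRing F
  rw [polyEqZero, sat_ring]
  simp [Formula.realize_equal]

theorem sat_memSubfield (a : α) : Sat k S (memSubfield a) v ↔ v a ∈ k := by
  let := pairSetStructure k S
  exact Formula.realize_rel

theorem sat_memSet (a : Fin n → α) : Sat k S (memSet a) v ↔ (fun i => v (a i)) ∈ S := by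
  let := pairSetStructure k S
  exact Formula.realize_rel

theorem sat_pair (φ : pairLang.Formula α) :
    Sat k S ((LHom.sumInl : pairLang →ᴸ pairSetLang n).onFormula φ) v ↔
      letI := pairStructure k
      φ.Realize v := by
  let := pairStructure k
  let := newRelStructure S
  exact LHom.realize_onFormula _ φ

theorem sat_not (φ : (pairSetLang n).Formula α) : Sat k S φ.not v ↔ ¬ Sat k S φ v := by
  let := pairSetStructure k S
  exact Formula.realize_not

theorem sat_inf (φ ψ : (pairSetLang n).Formula α) :
    Sat k S (φ ⊓ ψ) v ↔ Sat k S φ v ∧ Sat k S ψ v := by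
  let := pairSetStructure k S
  exact Formula.realize_inf

theorem sat_sup (φ ψ : (pairSetLang n).Formula α) :
    Sat k S (φ ⊔ ψ) v ↔ Sat k S φ v ∨ Sat k S ψ v := by
  let := pairSetStructure k S
  exact Formula.realize_sup

theorem sat_iff (φ ψ : (pairSetLang n).Formula α) :
    Sat k S (φ.iff ψ) v ↔ (Sat k S φ v ↔ Sat k S ψ v) := by
  let := pairSetStructure k S
  exact Formula.realize_iff

theorem sat_iSup [Finite β] (φ : β → (pairSetLang n).Formula α) :
    Sat k S (BoundedFormula.iSup φ) v ↔ ∃ b, Sat k S (φ b) v := by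
  let := pairSetStructure k S
  exact BoundedFormula.realize_iSup

theorem sat_iInf [Finite β] (φ : β → (pairSetLang n).Formula α) :
    Sat k S (BoundedFormula.iInf φ) v ↔ ∀ b, Sat k S (φ b) v := by
  let := pairSetStructure k S
  exact BoundedFormula.realize_iInf

theorem sat_iExs [Finite β] (φ : (pairSetLang n).Formula (α ⊕ β)) :
    Sat k S (Formula.iExs β φ) v ↔ ∃ w : β → F, Sat k S φ (Sum.elim v w) := by
  let := pairSetStructure k S
  exact BoundedFormula.realize_iExs

theorem sat_iAlls [Finite β] (φ : (pairSetLang n).Formula (α ⊕ β)) :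
    Sat k S (Formula.iAlls β φ) v ↔ ∀ w : β → F, Sat k S φ (Sum.elim v w) := by
  let := pairSetStructure k S
  exact BoundedFormula.realize_iAlls

end ModelTheory

/-! ### Saturated elementary extensions -/

namespace SatExt
open FirstOrder FirstOrder.Language
variable {n : ℕ} {α : Type*} {K : Type u} [Field K] {k : Subfield K} {S : Set (Fin n → K)}
  (E : SatExt k S)

/-- The elementary embedding of `K` into the extension, as a function. -/
def map : K → E.F :=
  letI := pairSetStructure k S
  letI := pairSetStructure E.k' E.S'
  E.emb

/-- The embedding is elementary. -/
theorem sat_map (φ : (pairSetLang n).Formula α) (v : α → K) :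
    Sat E.k' E.S' φ (E.map ∘ v) ↔ Sat k S φ v := by
  let := pairSetStructure k S
  let := pairSetStructure E.k' E.S'
  exact E.emb.map_formula φ v

theorem forall_sat_map {β : Type*} [Finite β] (φ : (pairSetLang n).Formula (α ⊕ β)) (v : α → K) :
    (∀ w, Sat E.k' E.S' φ (Sum.elim (E.map ∘ v) w)) ↔ ∀ w, Sat k S φ (Sum.elim v w) := by
  rw [← sat_iAlls, ← sat_iAlls, sat_map]

open FreeCommRing in
/-- The elementary embedding as a ring homomorphism. -/
def ringHom : K →+* E.F where
  toFun := E.map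
  map_one' := by
    have := (E.sat_map (polyEqZero (of (0 : Fin 1) - 1)) ![1]).2 ((sat_polyEqZero _).2 (by simp))
    simpa [sat_polyEqZero, sub_eq_zero] using this
  map_zero' := by
    have := (E.sat_map (polyEqZero (of (0 : Fin 1))) ![0]).2 ((sat_polyEqZero _).2 (by simp))
    simpa [sat_polyEqZero, sub_eq_zero] using this
  map_mul' a b := by
    have := (E.sat_map (polyEqZero (of (0 : Fin 3) - of 1 * of 2)) ![a * b, a, b]).2
      ((sat_polyEqZero _).2 (by simp))
    simpa [sat_polyEqZero, sub_eq_zero] using this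
  map_add' a b := by
    have := (E.sat_map (polyEqZero (of (0 : Fin 3) - (of 1 + of 2))) ![a + b, a, b]).2
      ((sat_polyEqZero _).2 (by simp))
    simpa [sat_polyEqZero, sub_eq_zero] using this

theorem isAlgClosed [IsAlgClosed K] : IsAlgClosed E.F := by
  refine IsAlgClosed.of_exists_root _ fun p hpm hpi => ?_
  let := FirstOrder.Ring.compatibleRingOfRing K
  let := FirstOrder.Ring.compatibleRingOfRing E.F
  have h : K ⊨ FirstOrder.Field.genericMonicPolyHasRoot p.natDegree := by
    rw [FirstOrder.Field.realize_genericMonicPolyHasRoot]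
    rintro ⟨q, _, hq⟩
    exact IsAlgClosed.exists_root q (Polynomial.natDegree_pos_iff_degree_pos.1
      (hq ▸ hpi.natDegree_pos)).ne'
  have h' : E.F ⊨ FirstOrder.Field.genericMonicPolyHasRoot p.natDegree := by
    have := (E.sat_map _ _).2 ((sat_ring (k := k) (S := S) _).2 h)
    rw [sat_ring, Subsingleton.elim (E.map ∘ _) default] at this
    exact this
  rw [FirstOrder.Field.realize_genericMonicPolyHasRoot] at h'
  exact h' ⟨p, hpm, rfl⟩

/-- Compactness for saturated extensions: if the sets defined by a family of formulas over `K`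
cover the extension, then finitely many of them do. Otherwise the negated formulas would form a
finitely satisfiable type over the image of `K`, which has fewer than `κ` elements. -/
theorem exists_finset_cover {ι : Type*} (φ : ι → (pairSetLang n).Formula (K ⊕ Fin 1))
    (h : ∀ w, ∃ i, Sat E.k' E.S' (φ i) (Sum.elim E.map w)) :
    ∃ t : Finset ι, ∀ w, ∃ i ∈ t, Sat E.k' E.S' (φ i) (Sum.elim E.map w) := by
  classical
  let := pairSetStructure E.k' E.S'
  by_contra! hcon
  let A : Set E.F := Set.range E.map
  let ψ : ι → ((pairSetLang n).withConstants A).Formula (Fin 1) := fun i =>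
    BoundedFormula.constantsVarsEquiv.symm
      ((φ i).not.relabel (Sum.map (fun a => (⟨E.map a, a, rfl⟩ : A)) id))
  have hψ : ∀ i w, (ψ i).Realize w ↔ ¬ Sat E.k' E.S' (φ i) (Sum.elim E.map w) := fun i w => by
    rw [← sat_not]
    unfold Formula.Realize
    rw [← BoundedFormula.realize_constantsVarsEquiv]
    simp only [ψ, Equiv.apply_symm_apply]
    refine Formula.realize_relabel.trans ?_
    refine iff_of_eq (congrArg (Sat E.k' E.S' (φ i).not) ?_)
    ext (a | a) <;> rfl
  obtain ⟨w, hw⟩ := E.saturated A (Cardinal.mk_range_le.trans_lt E.card_lt) (Set.range ψ)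
    fun q hq => by
      choose g hg using hq
      obtain ⟨w, hw⟩ := hcon (q.attach.image fun a => g a.2)
      refine ⟨w, fun χ hχ => ?_⟩
      rw [← hg hχ, hψ]
      exact hw _ (Finset.mem_image.2 ⟨⟨χ, hχ⟩, Finset.mem_attach _ _, rfl⟩)
  obtain ⟨i, hi⟩ := h w
  exact (hψ i w).1 (hw _ ⟨i, rfl⟩) hi

end SatExt

section Dimension
open FirstOrder FirstOrder.Language FreeCommRing
variable {n : ℕ} {K F : Type u} [Field F]

/-! ### Small sets -/

/-- The formula defining `Locus.Mem`. The elements of `K` occur as variables, to be evaluated at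
themselves or at their images in an extension; the variable in `Fin 1` stands for `x`. -/
noncomputable def Locus.formula (I : Locus K) : (pairSetLang n).Formula (K ⊕ Fin 1) :=
  let c : Fin I.d → FreeCommRing ((K ⊕ Fin 1) ⊕ (Σ i, Fin (I.m i))) := fun i =>
    ∑ j, of (Sum.inl (Sum.inl (I.b i j))) * of (Sum.inr ⟨i, j⟩)
  Formula.iExs (Σ i, Fin (I.m i))
    (BoundedFormula.iInf (fun p => memSubfield (Sum.inr p)) ⊓
      (BoundedFormula.iSup (fun i => (polyEqZero (c i)).not) ⊓
        polyEqZero (∑ i, c i * of (Sum.inl (Sum.inr 0)) ^ (i : ℕ))))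

theorem Locus.sat_formula (I : Locus K) {k' : Subfield F} {S' : Set (Fin n → F)} (f : K → F)
    (w : Fin 1 → F) : Sat k' S' I.formula (Sum.elim f w) ↔ I.Mem k' f (w 0) := by
  rw [formula, sat_iExs]
  refine exists_congr fun y => ?_
  simp only [sat_inf, sat_iInf, sat_iSup, sat_not, sat_memSubfield, sat_polyEqZero, coeff, map_sum,
    map_mul, map_pow, lift_of, Sum.elim_inl, Sum.elim_inr, ne_eq]

variable [Field K]

/-- `T` is small if finitely many nontrivial equations, with auxiliary unknowns in `k`, have every
element of `T` among their solutions. -/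
def IsSmall (k : Subfield K) (T : Set K) : Prop :=
  ∃ t : Finset (Locus K), ∀ x ∈ T, ∃ I ∈ t, I.Mem k id x

namespace SatExt
variable {k : Subfield K} {T : Set K}

/-- Finitely many given equations cover `T` by virtue of a first-order sentence, which therefore
holds in every elementary extension. -/
theorem isAlgebraic_of_isSmall (hT : IsSmall k T) (E : SatExt k {v : Fin 1 → K | v 0 ∈ T})
    {s : Fin 1 → E.F} (hs : s ∈ E.S') : _root_.IsAlgebraic E.base (s 0) := by
  obtain ⟨t, ht⟩ := hT
  let φ : (pairSetLang 1).Formula (K ⊕ Fin 1) :=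
    (memSet Sum.inr).not ⊔ BoundedFormula.iSup (fun I : t => I.1.formula)
  have hφ : ∀ w : Fin 1 → K, Sat k {v | v 0 ∈ T} φ (Sum.elim id w) := fun w => by
    simp only [φ, sat_sup, sat_not, sat_memSet, sat_iSup, Locus.sat_formula, Sum.elim_inr]
    by_cases hw : w 0 ∈ T
    · obtain ⟨I, hI, h⟩ := ht _ hw
      exact Or.inr ⟨⟨I, hI⟩, h⟩
    · exact Or.inl hw
  have := (E.forall_sat_map φ id).2 hφ s
  simp only [φ, sat_sup, sat_not, sat_memSet, sat_iSup, Function.comp_id, Locus.sat_formula,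
    Sum.elim_inr] at this
  obtain h | ⟨I, h⟩ := this
  · exact absurd hs h
  · exact h.isAlgebraic

/-- If all points outside `S'` are algebraic over `K k'`, then the complement of `T` is small, by
saturation. -/
theorem isSmall_compl (E : SatExt k {v : Fin 1 → K | v 0 ∈ T})
    (h : ∀ s, s ∉ E.S' → _root_.IsAlgebraic E.base (s 0)) : IsSmall k Tᶜ := by
  -- The index `none` stands for the named set itself.
  have hcover : ∀ w, ∃ i : Option (Locus K), Sat E.k' E.S' (i.elim (memSet Sum.inr) Locus.formula)
      (Sum.elim E.map w) := fun w => by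
    by_cases hw : w ∈ E.S'
    · exact ⟨none, (sat_memSet _).2 hw⟩
    · obtain ⟨I, hI⟩ := Locus.exists_mem_of_isAlgebraic (f := E.ringHom) (h w hw)
      exact ⟨some I, (I.sat_formula _ _).2 hI⟩
  obtain ⟨t, ht⟩ := E.exists_finset_cover _ hcover
  let φ : (pairSetLang 1).Formula (K ⊕ Fin 1) :=
    BoundedFormula.iSup (fun i : t => i.1.elim (memSet Sum.inr) Locus.formula)
  have hφ := (E.forall_sat_map φ id).1 fun w =>
    let ⟨i, hi, h⟩ := ht w
    (sat_iSup _).2 ⟨⟨i, hi⟩, h⟩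
  refine ⟨t.eraseNone, fun x hx => ?_⟩
  obtain ⟨⟨i, hi⟩, h⟩ := (sat_iSup _).1 (hφ fun _ => x)
  cases i with
  | none => exact absurd ((sat_memSet _).1 h) hx
  | some I => exact ⟨I, Finset.mem_eraseNone.2 hi, (I.sat_formula _ _).1 h⟩

theorem rk_eq_zero {S : Set (Fin n → K)} (E : SatExt k S) {s : Fin n → E.F}
    (hs : ∀ i, _root_.IsAlgebraic E.base (s i)) : E.rk s = 0 := by
  have : Algebra.IsAlgebraic E.base (IntermediateField.adjoin E.base (Set.range s)) :=
    IntermediateField.isAlgebraic_adjoin (by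
      rintro _ ⟨i, rfl⟩
      exact (hs i).isIntegral)
  exact trdeg_eq_zero

/-- An automorphism over `K k'` is an automorphism of the pair `(F, k')` fixing all parameters, so
it preserves `S'` when `T` is definable in `(K, k)`. -/
theorem mem_of_algEquiv (hT : DefinableInPair k T) (E : SatExt k {v : Fin 1 → K | v 0 ∈ T})
    (σ : E.F ≃ₐ[E.base] E.F) {s : Fin 1 → E.F} (hs : s ∈ E.S') : σ ∘ s ∈ E.S' := by
  obtain ⟨φ, hφ⟩ := (letI := pairStructure k; Set.definable_iff_exists_formula_sum.1 hT)
  -- The definition of `T` in `(K, k)` also defines `S'` in `(F, k')`, by elementarity.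
  let ψ : (pairSetLang 1).Formula (K ⊕ Fin 1) :=
    (LHom.sumInl : pairLang →ᴸ pairSetLang 1).onFormula (φ.relabel (Sum.map (↑) id))
  have hψ : ∀ w, Sat E.k' E.S' ψ (Sum.elim E.map w) ↔ w ∈ E.S' := by
    have := (E.forall_sat_map (ψ.iff (memSet Sum.inr)) id).2 fun w => by
      rw [sat_iff, sat_memSet, sat_pair]
      let := pairStructure k
      rw [Formula.realize_relabel]
      refine Iff.trans ?_ (Set.ext_iff.1 hφ w).symm
      refine iff_of_eq (congrArg φ.Realize ?_)
      ext (a | a) <;> rfl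
    intro w
    have := this w
    rwa [sat_iff, sat_memSet] at this
  have hbase : ∀ x (hx : x ∈ E.base), σ x = x := fun x hx => σ.commutes ⟨x, hx⟩
  have hk : ∀ x ∈ E.k', σ x = x := fun x hx => hbase x (Subfield.subset_closure (Or.inr hx))
  have hK : σ ∘ E.map = E.map := funext fun a =>
    hbase _ (Subfield.subset_closure (Or.inl ⟨a, rfl⟩))
  have hk' : ∀ x, σ x ∈ E.k' ↔ x ∈ E.k' := fun x =>
    ⟨fun h => σ.injective (hk _ h) ▸ h, fun h => (hk x h).symm ▸ h⟩
  let := pairStructure E.k'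
  let σ' : pairLang.Equiv E.F E.F :=
    { σ.toEquiv with
      map_fun' := fun {n} f x => by
        rcases f with f | f
        · cases f
          · exact map_add σ _ _
          · exact map_mul σ _ _
          · exact map_neg σ _
          · exact map_zero σ
          · exact map_one σ
        · exact f.elim
      map_rel' := fun {n} r x => by
        rcases r with r | r
        · exact r.elim
        · cases r
          exact hk' _ }
  rw [← hψ, sat_pair] at hs ⊢
  have := (StrongHomClass.realize_formula σ' _).2 hs
  convert this using 1
  conv_lhs => rw [← hK]
  ext (a | a) <;> rfl

end SatExt

theorem IsSmall.dim₂One_le {k : Subfield K} {T : Set K} (hT : IsSmall k T) : dim₂One k T ≤ 0 := by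
  refine iSup_le fun E => iSup_le fun s => iSup_le fun hs => ?_
  have := E.rk_eq_zero (s := s) fun i => by
    rw [Subsingleton.elim i 0]
    exact E.isAlgebraic_of_isSmall hT hs
  simp [this]

/-- A single extension in which `S'` contains a point transcendental over `K k'` already shows that
the complement is small, as `S'` then contains all such points by conjugacy. -/
theorem dim₂One_le_or_isSmall_compl [IsAlgClosed K] {k : Subfield K} {T : Set K}
    (hT : DefinableInPair k T) : dim₂One k T ≤ 0 ∨ IsSmall k Tᶜ := by
  by_cases h : ∃ (E : SatExt k {v : Fin 1 → K | v 0 ∈ T}) (s : Fin 1 → E.F),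
      s ∈ E.S' ∧ Transcendental E.base (s 0)
  · right
    obtain ⟨E, s, hs, hst⟩ := h
    refine E.isSmall_compl fun s' => ?_
    contrapose!
    intro hs't
    have := E.isAlgClosed
    obtain ⟨σ, hσ⟩ := exists_algEquiv_map_eq_of_transcendental hst hs't
    have := E.mem_of_algEquiv hT σ hs
    rwa [show σ ∘ s = s' from funext fun i => by rw [Subsingleton.elim i 0]; exact hσ] at this
  · left
    push Not at h
    refine iSup_le fun E => iSup_le fun s => iSup_le fun hs => ?_
    have := E.rk_eq_zero (s := s) fun i => by
      rw [Subsingleton.elim i 0]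
      exact not_not.1 (h E s hs)
    simp [this]

end Dimension

end PairACF

theorem proposition1p1 {K : Type u} [Field K] [IsAlgClosed K] (k : Subfield K) [IsAlgClosed k]
    (hk : k ≠ ⊤) (S : Set K) (hS : PairACF.DefinableInPair k S) :
    PairACF.dim₂One k S ≤ 0 ∨ PairACF.dim₂One k Sᶜ ≤ 0 :=
  (PairACF.dim₂One_le_or_isSmall_compl hS).imp_right PairACF.IsSmall.dim₂One_le
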